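/- Let $k$ be an algebraically closed field of characteristic zero, let $I\subset k[X_0,\dots,X_n]$ be a homogeneous ideal, and let $A_X=k[X_0,\dots,X_n]/I$ be the graded coordinate ring of the cone $X\subset\mathbb{A}^{n+1}$ defined by $I$ (or, when $I$ is saturated, of the projective subscheme $X\subset\mathbb{P}^n$ defined by $I$). Suppose that $X$ is arithmetically Gorenstein, i.e. that $A_X$ is a Gorenstein ring (it is Noetherian, and each of its localizations at a maximal ideal has finite injective dimension over itself). Let $m_0\le m_1\le\dots\le m_{d-1}$ be the characteristic sequence of $X$: for some $A_X$-regular sequence of linear forms $Y_0,\dots,Y_{r-1}$ with $r=\dim A_X$ (Krull dimension), $A_X$ is a free module over $k[Y_0,\dots,Y_{r-1}]$ with a basis $e_0,\dots,e_{d-1}$ in which $e_i$ is homogeneous of degree $m_i$. (This sequence depends only on the Hilbert function of $A_X$.) Then, for all $0\le i\le d-1$, $$m_i+m_{d-1-i}=m_{d-1}.$$ -/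

import Mathlib

attribute [local instance] MvPolynomial.gradedAlgebra

/-- A commutative ring is *Gorenstein* if it is Noetherian and each of its localizations at a
maximal ideal has finite injective dimension as a module over itself. -/
def IsGorensteinRing (R : Type*) [CommRing R] : Prop :=
  IsNoetherianRing R ∧
    ∀ (p : Ideal R) [p.IsMaximal], ∃ N : ℕ,
      CategoryTheory.HasInjectiveDimensionLE
        (ModuleCat.of (Localization.AtPrime p) (Localization.AtPrime p)) N

/-- The graded coordinate ring `A_X = k[X₀, …, Xₙ] / I` of the cone (or of the projective
subscheme of `ℙⁿ`) `X` defined by the homogeneous ideal `I`. -/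
abbrev CoordRing {k : Type*} [Field k] {n : ℕ} (I : Ideal (MvPolynomial (Fin (n + 1)) k)) :
    Type _ :=
  MvPolynomial (Fin (n + 1)) k ⧸ I

/-- `X` is *arithmetically Gorenstein* if its graded coordinate ring is a Gorenstein ring. -/
def IsArithmeticallyGorenstein {k : Type*} [Field k] {n : ℕ}
    (I : Ideal (MvPolynomial (Fin (n + 1)) k)) : Prop :=
  IsGorensteinRing (CoordRing I)

/-- An element of `A_X` is homogeneous of degree `l` if it is the class of a homogeneous
polynomial of degree `l`. -/
def CoordRing.IsHomogeneousOfDegree {k : Type*} [Field k] {n : ℕ}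
    (I : Ideal (MvPolynomial (Fin (n + 1)) k)) (a : CoordRing I) (l : ℕ) : Prop :=
  ∃ P : MvPolynomial (Fin (n + 1)) k, P.IsHomogeneous l ∧ Ideal.Quotient.mk I P = a

/-- The nondecreasing sequence `(m₀, …, m_{d-1})` is the *characteristic sequence* of `X`: for
some `A_X`-regular sequence of linear forms `Y₀, …, Y_{r-1}`, where `r = dim A_X`, the
`k[Y₀, …, Y_{r-1}]`-module `A_X` has a basis `(e₀, …, e_{d-1})` with `e_i` homogeneous of
degree `m_i`. -/
def IsCharacteristicSequence {k : Type*} [Field k] {n : ℕ}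
    (I : Ideal (MvPolynomial (Fin (n + 1)) k)) {d : ℕ} (m : Fin d → ℕ) : Prop :=
  Monotone m ∧
    ∃ (r : ℕ) (Y : Fin r → MvPolynomial (Fin (n + 1)) k),
      ringKrullDim (CoordRing I) = r ∧
      (∀ j, (Y j).IsHomogeneous 1) ∧
      RingTheory.Sequence.IsRegular (CoordRing I) (List.ofFn Y) ∧
      ∃ e : Module.Basis (Fin d) (Algebra.adjoin k (Set.range Y)) (CoordRing I),
        ∀ i, CoordRing.IsHomogeneousOfDegree I (e i) (m i)

/-! Put `B = A_X/(Y)`. It is a finite-dimensional graded `k`-algebra with basis the classes of the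
`e_i`, in degrees `m_i`. The class of `e_{d-1}` has top degree, so the irrelevant ideal kills it. If
every nonzero ideal of `B` contains this class, the pairing sending `(x, y)` to the coefficient of
`x * y` at `e_{d-1}` is nondegenerate. A nonzero term of its Gram determinant is a permutation `σ`
with `m (σ j) + m j = m_{d-1}`, and monotonicity of `m` lets order reversal replace `σ`
(`Module.Basis.degree_add_degree_rev`).

The socle property comes from the Gorenstein hypothesis at the irrelevant maximal ideal. Over the
local ring `R` there, let `rs` be the images of `Y`. Finite injective dimension forces `Ext^i(M, R)
= 0` for `M` of finite length and `i > rs.length`, so restriction from `Ext^l(R/(rs), R)` to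
`Ext^l(P, R)` is onto for `l = rs.length` and `P` a submodule of `R/(rs)`. Dimension shifting turns
this into extension of maps `P → R/(rs)`. For `s ≠ 0` and `t` in the socle, the map `s ↦ t` extends
to `R/(rs)`, whence `t` is a multiple of `s`. -/

/-! ### Ext and dimension shifting along a regular sequence. -/

open CategoryTheory Abelian in
theorem CategoryTheory.ShortComplex.ShortExact.ext_succ_eq_zero {C : Type*} [Category C]
    [Abelian C] [HasExt C] {S : ShortComplex C} (hS : S.ShortExact) (M : C) {i : ℕ}
    (h : ∀ z : Ext M S.X₃ i, z = 0) (x : Ext M S.X₁ (i + 1))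
    (hx : x.comp (Ext.mk₀ S.f) (add_zero _) = 0) : x = 0 := by
  obtain ⟨z, rfl⟩ := Ext.covariant_sequence_exact₁ M hS x hx rfl
  rw [h z, Ext.zero_comp]

open CategoryTheory Abelian in
/-- If `S.f` induces zero on `Ext^(i+1)(M', -)` and `Ext^i(M, S.X₂) = 0`, then surjectivity of
restriction along `ι : M ⟶ M'` passes from `Ext^(i+1)(-, S.X₁)` to `Ext^i(-, S.X₃)`. -/
theorem CategoryTheory.ShortComplex.ShortExact.exists_ext_extension {C : Type*} [Category C]
    [Abelian C] [HasExt C] {S : ShortComplex C} (hS : S.ShortExact) {M M' : C} (ι : M ⟶ M')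
    {i : ℕ} (h₂ : ∀ w : Ext M S.X₂ i, w = 0)
    (h₁ : ∀ y : Ext M' S.X₁ (i + 1), y.comp (Ext.mk₀ S.f) (add_zero _) = 0)
    (H : ∀ x : Ext M S.X₁ (i + 1),
      ∃ z : Ext M' S.X₁ (i + 1), (Ext.mk₀ ι).comp z (zero_add _) = x)
    (x : Ext M S.X₃ i) : ∃ z : Ext M' S.X₃ i, (Ext.mk₀ ι).comp z (zero_add _) = x := by
  obtain ⟨y, hy⟩ := H (x.comp hS.extClass rfl)
  obtain ⟨z, rfl⟩ := Ext.covariant_sequence_exact₁ M' hS y (h₁ y) rfl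
  refine ⟨z, ?_⟩
  have h0 : ((Ext.mk₀ ι).comp z (zero_add _) - x).comp hS.extClass rfl = 0 := by
    rw [sub_eq_add_neg, Ext.add_comp, Ext.neg_comp, ← hy, ← sub_eq_add_neg, sub_eq_zero]
    rw [Ext.comp_assoc]
    simp
  obtain ⟨w, hw⟩ := Ext.covariant_sequence_exact₃ M hS _ rfl h0
  rw [h₂ w, Ext.zero_comp] at hw
  exact sub_eq_zero.1 hw.symm

open CategoryTheory Abelian in
/-- If a weakly `N`-regular sequence kills `M`, then `Ext^i(M, N) = 0` below its length. -/
theorem RingTheory.Sequence.IsWeaklyRegular.ext_eq_zero {R : Type*} [CommRing R]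
    (M : ModuleCat R) {rs : List R} (hM : ∀ r ∈ rs, r ∈ Module.annihilator R M)
    {N : ModuleCat R} (hN : IsWeaklyRegular N rs) {i : ℕ}
    (hi : i < rs.length) (x : Ext M N i) : x = 0 := by
  induction rs generalizing N i with
  | nil => simp at hi
  | cons r rs ih =>
    rw [isWeaklyRegular_cons_iff] at hN
    have hS := IsSMulRegular.smulShortComplex_shortExact hN.1
    -- Multiplication by `r` on `N` acts on Ext as multiplication by `r` on `M`, which is zero.
    have hx : x.comp (Ext.mk₀ (ModuleCat.smulShortComplex N r).f) (add_zero i) = 0 :=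
      congr($(Ext.postcomp_smul_id_eq_zero_of_mem_annihilator (M := N) (hM r (by simp)) i) x)
    cases i with
    | zero =>
      exact @Ext.postcomp_mk₀_injective_of_mono _ _ _ _ M _ _ _ hS.mono_f x 0
        (hx.trans (map_zero ((Ext.mk₀ _).postcomp M _)).symm)
    | succ i =>
      exact hS.ext_succ_eq_zero M (ih (N := ModuleCat.of R (QuotSMulTop r N))
        (fun r hr ↦ hM r (by simp [hr])) hN.2 (by simpa using hi)) x hx

open CategoryTheory Abelian in
/-- Dimension shifting along a regular sequence: if every class in `Ext^l(M, N)` extends along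
`ι : M → M'`, where `l` is the length of a weakly `N`-regular sequence that kills `M` and `M'`,
then every map from `M` to the quotient of `N` by that sequence extends along `ι`. -/
theorem RingTheory.Sequence.IsWeaklyRegular.exists_extension {R : Type*} [CommRing R]
    {M M' : ModuleCat R} (ι : M ⟶ M') {rs : List R}
    (hM : ∀ r ∈ rs, r ∈ Module.annihilator R M) (hM' : ∀ r ∈ rs, r ∈ Module.annihilator R M')
    {N : ModuleCat R} (hN : IsWeaklyRegular N rs)
    (H : ∀ x : Ext M N rs.length,
      ∃ z : Ext M' N rs.length, (Ext.mk₀ ι).comp z (zero_add _) = x)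
    (f : M →ₗ[R] N ⧸ (Ideal.ofList rs • ⊤ : Submodule R N)) :
    ∃ g : M' →ₗ[R] N ⧸ (Ideal.ofList rs • ⊤ : Submodule R N), g ∘ₗ ι.hom = f := by
  induction rs generalizing N with
  | nil =>
    let e : (N ⧸ (Ideal.ofList ([] : List R) • ⊤ : Submodule R N)) ≃ₗ[R] N :=
      Submodule.quotEquivOfEqBot _ (by simp)
    obtain ⟨z, hz⟩ := H (Ext.mk₀ (ModuleCat.ofHom (e.toLinearMap ∘ₗ f)))
    obtain ⟨g, rfl⟩ := (Ext.mk₀_bijective _ _).2 z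
    have h := congr(ModuleCat.Hom.hom
      $((Ext.mk₀_bijective _ _).1 ((Ext.mk₀_comp_mk₀ ι g).symm.trans hz)))
    refine ⟨e.symm.toLinearMap ∘ₗ g.hom, LinearMap.ext fun x ↦ ?_⟩
    exact (LinearEquiv.symm_apply_eq e).2 congr($h x)
  | cons r rs ih =>
    have hN' := (isWeaklyRegular_cons_iff _ _ _).1 hN
    have hS := IsSMulRegular.smulShortComplex_shortExact hN'.1
    let e := Submodule.quotOfListConsSMulTopEquivQuotSMulTopInner N r rs
    obtain ⟨g, hg⟩ := ih (N := ModuleCat.of R (QuotSMulTop r N))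
      (fun r hr ↦ hM r (by simp [hr])) (fun r hr ↦ hM' r (by simp [hr])) hN'.2
      (hS.exists_ext_extension ι (hN.ext_eq_zero M hM (by simp))
        (fun y ↦ congr($(Ext.postcomp_smul_id_eq_zero_of_mem_annihilator (M := N)
            (hM' r (by simp)) _) y)) H) (e.toLinearMap ∘ₗ f)
    refine ⟨e.symm.toLinearMap ∘ₗ g, LinearMap.ext fun x ↦ ?_⟩
    exact (LinearEquiv.symm_apply_eq e).2 congr($hg x)

/-! ### Finite self-injective dimension and the socle of a local ring modulo parameters. -/

theorem Submodule.shortExact_subtype_mkQ {R M : Type*} [CommRing R] [AddCommGroup M] [Module R M]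
    (P : Submodule R M) :
    (ModuleCat.shortComplexOfCompEqZero P.subtype P.mkQ (by ext; simp)).ShortExact where
  exact := ModuleCat.shortComplex_exact _ (LinearMap.exact_subtype_mkQ P)
  mono_f := (ModuleCat.mono_iff_injective _).2 P.subtype_injective
  epi_g := (ModuleCat.epi_iff_surjective _).2 P.mkQ_surjective

-- Dévissage along a composition series: a class that restricts to zero on `P` comes from the simple
-- quotient.
open CategoryTheory Abelian in
theorem ModuleCat.ext_eq_zero_of_isFiniteLength {R : Type*} [CommRing R] {N : ModuleCat R} {i : ℕ}
    (h : ∀ M : ModuleCat R, IsSimpleModule R M → ∀ x : Ext M N i, x = 0)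
    (M : ModuleCat R) (hM : IsFiniteLength R M) (x : Ext M N i) : x = 0 := by
  suffices H : ∀ (M : Type _) [AddCommGroup M] [Module R M], IsFiniteLength R M →
      ∀ x : Ext (ModuleCat.of R M) N i, x = 0 from H M hM x
  intro M _ _ hM
  induction hM with
  | of_subsingleton =>
    intro x
    exact ((ModuleCat.isZero_of_subsingleton _).hasProjectiveDimensionLT_zero).subsingleton
      (hi := Nat.zero_le i) (Y := N) |>.elim _ _
  | @of_simple_quotient M _ _ P _ _ ih =>
    intro x
    obtain ⟨z, rfl⟩ := Ext.contravariant_sequence_exact₂ P.shortExact_subtype_mkQ N x (ih _)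
    rw [h _ ‹_› z]
    exact Ext.comp_zero ..

theorem IsLocalRing.nonempty_linearEquiv_of_isSimpleModule {R M M' : Type*} [CommRing R]
    [IsLocalRing R] [AddCommGroup M] [Module R M] [AddCommGroup M'] [Module R M']
    (hM : IsSimpleModule R M) (hM' : IsSimpleModule R M') : Nonempty (M ≃ₗ[R] M') := by
  obtain ⟨I, hI, ⟨e⟩⟩ := isSimpleModule_iff_quot_maximal.1 hM
  obtain ⟨I', hI', ⟨e'⟩⟩ := isSimpleModule_iff_quot_maximal.1 hM'
  obtain rfl := (IsLocalRing.eq_maximalIdeal hI).trans (IsLocalRing.eq_maximalIdeal hI').symm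
  exact ⟨e.trans e'.symm⟩

open CategoryTheory Abelian RingTheory.Sequence in
/-- Over a local ring of finite self-injective dimension with a system of parameters `rs` that is
a regular sequence, `Ext^i(M, R) = 0` for all `M` of finite length and `i > rs.length`. -/
theorem RingTheory.Sequence.IsWeaklyRegular.ext_self_eq_zero_of_isFiniteLength {R : Type*}
    [CommRing R] [IsLocalRing R] [IsNoetherianRing R] {N : ℕ}
    (hinj : HasInjectiveDimensionLE (ModuleCat.of R R) N) {rs : List R}
    (hmem : ∀ r ∈ rs, r ∈ IsLocalRing.maximalIdeal R) (hreg : IsWeaklyRegular R rs)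
    (hfin : IsFiniteLength R (R ⧸ (Ideal.ofList rs • ⊤ : Submodule R R)))
    {i : ℕ} (hi : rs.length < i) (M : ModuleCat R) (hM : IsFiniteLength R M)
    (x : Ext M (ModuleCat.of R R) i) : x = 0 := by
  let B := R ⧸ (Ideal.ofList rs • ⊤ : Submodule R R)
  obtain ⟨_, _⟩ := isFiniteLength_iff_isNoetherian_isArtinian.1 hfin
  have hpd : HasProjectiveDimensionLE (ModuleCat.of R B) rs.length := by
    rw [← projectiveDimension_le_iff]
    refine (ModuleCat.projectiveDimension_quotient_eq_add_length_of_isWeaklyRegular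
      (ModuleCat.of R R) rs hreg hmem).trans_le ?_
    have : projectiveDimension (ModuleCat.of R R) ≤ (0 : ℕ) := by
      rw [projectiveDimension_le_iff]
      infer_instance
    simpa using add_le_add_left this (rs.length : WithBot ℕ∞)
  have hB : Nontrivial B := by
    refine Submodule.Quotient.nontrivial_iff.2 fun h ↦ ?_
    have : Ideal.ofList rs ≤ IsLocalRing.maximalIdeal R := Ideal.span_le.2 hmem
    simp only [smul_eq_mul, Ideal.mul_top] at h
    exact (IsLocalRing.maximalIdeal.isMaximal R).ne_top (top_le_iff.1 (h ▸ this))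
  obtain ⟨P, hP⟩ : ∃ P : Submodule R B, IsSimpleModule R P := by
    obtain ⟨P, hP, -⟩ := (eq_bot_or_exists_atom_le (⊤ : Submodule R B)).resolve_left top_ne_bot
    exact ⟨P, isSimpleModule_iff_isAtom.2 hP⟩
  by_cases hiN : N + 1 ≤ i
  · exact x.eq_zero_of_hasInjectiveDimensionLT (N + 1) hiN
  -- Descending induction on `i`, starting above the injective dimension.
  induction h : N + 1 - i generalizing i M with
  | zero => omega
  | succ j ih =>
    refine ModuleCat.ext_eq_zero_of_isFiniteLength (fun M hM x ↦ ?_) M hM x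
    have hnext : ∀ (M : ModuleCat R), IsFiniteLength R M →
        ∀ x : Ext M (ModuleCat.of R R) (i + 1), x = 0 := fun M hM x ↦ by
      by_cases h' : N + 1 ≤ i + 1
      · exact x.eq_zero_of_hasInjectiveDimensionLT (N + 1) h'
      · exact ih (by omega) M hM x h' (by omega)
    obtain ⟨e⟩ := IsLocalRing.nonempty_linearEquiv_of_isSimpleModule hM hP
    -- The simple module embeds in `B` as `P`. Since `Ext^(i+1)(B/P, R) = 0`, the class lifts to
    -- `Ext^i(B, R)`, which vanishes because `i` exceeds the projective dimension of `B`.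
    have hx : (Ext.mk₀ e.toModuleIso.inv).comp x (zero_add _) = 0 := by
      obtain ⟨y, hy⟩ := Ext.contravariant_sequence_exact₁ P.shortExact_subtype_mkQ
        (ModuleCat.of R R) ((Ext.mk₀ e.toModuleIso.inv).comp x (zero_add _)) (add_comm 1 i)
        (hnext _ (hfin.of_surjective P.mkQ_surjective) _)
      rw [← hy, y.eq_zero_of_hasProjectiveDimensionLT (rs.length + 1) hi]
      exact Ext.comp_zero ..
    have := congr((Ext.mk₀ e.toModuleIso.hom).comp $hx (zero_add _))
    rwa [Ext.mk₀_comp_mk₀_assoc, Iso.hom_inv_id, Ext.mk₀_id_comp, Ext.comp_zero] at this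

open CategoryTheory Abelian RingTheory.Sequence in
/-- Self-injectivity, restricted to extension of maps from submodules, of the quotient of a local
ring of finite self-injective dimension by a system of parameters. -/
theorem RingTheory.Sequence.IsWeaklyRegular.exists_extension_quotient {R : Type*}
    [CommRing R] [IsLocalRing R] [IsNoetherianRing R] {N : ℕ}
    (hinj : HasInjectiveDimensionLE (ModuleCat.of R R) N) {rs : List R}
    (hmem : ∀ r ∈ rs, r ∈ IsLocalRing.maximalIdeal R) (hreg : IsWeaklyRegular R rs)
    (hfin : IsFiniteLength R (R ⧸ (Ideal.ofList rs • ⊤ : Submodule R R)))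
    (P : Submodule R (R ⧸ (Ideal.ofList rs • ⊤ : Submodule R R)))
    (f : P →ₗ[R] R ⧸ (Ideal.ofList rs • ⊤ : Submodule R R)) :
    ∃ g : (R ⧸ (Ideal.ofList rs • ⊤ : Submodule R R)) →ₗ[R]
      R ⧸ (Ideal.ofList rs • ⊤ : Submodule R R), g ∘ₗ P.subtype = f := by
  have hann : ∀ r ∈ rs, r ∈ Module.annihilator R (R ⧸ (Ideal.ofList rs • ⊤ : Submodule R R)) :=
    fun r hr ↦ Module.mem_annihilator.2 fun m ↦ by
      obtain ⟨a, rfl⟩ := Submodule.mkQ_surjective _ m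
      rw [← map_smul, Submodule.mkQ_apply, Submodule.Quotient.mk_eq_zero]
      exact Submodule.smul_mem_smul (Ideal.subset_span hr) trivial
  refine hreg.exists_extension (M := ModuleCat.of R P) (N := ModuleCat.of R R)
    (M' := ModuleCat.of R (R ⧸ (Ideal.ofList rs • ⊤ : Submodule R R)))
    (ModuleCat.ofHom P.subtype) (fun r hr ↦ Module.mem_annihilator.2 fun m ↦ ?_) hann
    (fun x ↦ ?_) f
  · exact Subtype.ext (Module.mem_annihilator.1 (hann r hr) m)
  · exact Ext.contravariant_sequence_exact₁ P.shortExact_subtype_mkQ _ x (add_comm 1 _)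
      (hreg.ext_self_eq_zero_of_isFiniteLength hinj hmem hfin (Nat.lt_succ_self _) _
        (hfin.of_surjective P.mkQ_surjective) _)

/-- The cyclic module is `R` modulo the annihilator of `s`, and that annihilator kills `t`. -/
theorem LinearMap.exists_span_singleton_apply_eq {R M M' : Type*} [Ring R] [AddCommGroup M]
    [Module R M] [AddCommGroup M'] [Module R M'] (s : M) (t : M')
    (h : ∀ a : R, a • s = 0 → a • t = 0) :
    ∃ f : Submodule.span R {s} →ₗ[R] M', f ⟨s, Submodule.mem_span_singleton_self s⟩ = t := by
  let q := (LinearMap.toSpanSingleton R M s).quotKerEquivRange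
  let f := (LinearMap.ker (LinearMap.toSpanSingleton R M s)).liftQ
    (LinearMap.toSpanSingleton R M' t) h ∘ₗ q.symm.toLinearMap
  refine ⟨f ∘ₗ Submodule.inclusion (LinearMap.range_toSpanSingleton s).ge, ?_⟩
  have : q.symm ⟨s, 1, by simp⟩ = Submodule.Quotient.mk 1 :=
    (LinearEquiv.symm_apply_eq q).2 (Subtype.ext (one_smul R s).symm)
  exact (congrArg _ this).trans (one_smul R t)

open CategoryTheory RingTheory.Sequence in
/-- The socle of the quotient of a local ring of finite self-injective dimension by a system of
parameters lies in each nonzero ideal. -/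
theorem RingTheory.Sequence.IsWeaklyRegular.exists_sub_mul_mem_of_mem_socle {R : Type*}
    [CommRing R] [IsLocalRing R] [IsNoetherianRing R] {N : ℕ}
    (hinj : HasInjectiveDimensionLE (ModuleCat.of R R) N) {rs : List R}
    (hmem : ∀ r ∈ rs, r ∈ IsLocalRing.maximalIdeal R) (hreg : IsWeaklyRegular R rs)
    (hfin : IsFiniteLength R (R ⧸ Ideal.ofList rs)) {s t : R} (hs : s ∉ Ideal.ofList rs)
    (ht : ∀ a ∈ IsLocalRing.maximalIdeal R, a * t ∈ Ideal.ofList rs) :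
    ∃ a : R, t - a * s ∈ Ideal.ofList rs := by
  have htop : (Ideal.ofList rs • ⊤ : Submodule R R) = Ideal.ofList rs := by simp
  let π := (Ideal.ofList rs • ⊤ : Submodule R R).mkQ
  have hπ (x : R) : π x = 0 ↔ x ∈ Ideal.ofList rs := by
    rw [Submodule.mkQ_apply, Submodule.Quotient.mk_eq_zero, htop]
  obtain ⟨f, hf⟩ := LinearMap.exists_span_singleton_apply_eq (R := R) (π s) (π t) fun a ha ↦ by
    rw [← map_smul, hπ]
    -- A unit cannot kill the nonzero class of `s`, so `a` is in the maximal ideal and kills the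
    -- class of `t`.
    exact ht a fun hu ↦ hs ((hπ s).1 ((hu.smul_eq_zero).1 ha))
  obtain ⟨g, rfl⟩ := hreg.exists_extension_quotient hinj hmem
    ((Submodule.quotEquivOfEq _ _ htop).symm.isFiniteLength hfin) _ f
  obtain ⟨a, ha⟩ := Submodule.mkQ_surjective _ (g (π 1))
  refine ⟨a, (hπ _).1 ?_⟩
  have hs1 : π s = s • π 1 := by rw [← map_smul]; simp
  rw [map_sub, sub_eq_zero, ← hf]
  change g (π s) = _
  rw [hs1, map_smul, ← ha, ← map_smul]
  exact congrArg π (mul_comm s a)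

/-! ### Descent of the socle property from the localization. -/

open CategoryTheory RingTheory.Sequence in
/-- If `A_p` has finite self-injective dimension, then the socle of the Artinian local ring
`A ⧸ (ys)`, with `ys` a regular sequence in `p`, lies in each nonzero ideal. -/
theorem RingTheory.Sequence.IsWeaklyRegular.exists_sub_mul_mem_of_localization (k : Type*)
    {A : Type*} [Field k] [CommRing A] [Algebra k A] [IsNoetherianRing A] {N : ℕ} (p : Ideal A)
    [p.IsMaximal] (hinj : HasInjectiveDimensionLE
      (ModuleCat.of (Localization.AtPrime p) (Localization.AtPrime p)) N) {ys : List A}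
    (hmem : ∀ y ∈ ys, y ∈ p) (hreg : IsWeaklyRegular A ys)
    (hfin : Module.Finite k (A ⧸ Ideal.ofList ys))
    (hunit : ∀ u ∉ p, ∃ v, u * v - 1 ∈ Ideal.ofList ys) {s t : A} (hs : s ∉ Ideal.ofList ys)
    (ht : ∀ a ∈ p, a * t ∈ Ideal.ofList ys) : ∃ a : A, t - a * s ∈ Ideal.ofList ys := by
  let R := Localization.AtPrime p
  let rs := ys.map (algebraMap A R)
  have hrs : (Ideal.ofList ys).map (algebraMap A R) = Ideal.ofList rs := by simp [rs]
  -- Elements outside `p` are already units modulo `ys`, so `A/(ys) → R/(rs)` is injective, and by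
  -- `hsurj` surjective.
  have hcomap (x : A) (hx : algebraMap A R x ∈ Ideal.ofList rs) : x ∈ Ideal.ofList ys := by
    rw [← hrs, IsLocalization.algebraMap_mem_map_algebraMap_iff p.primeCompl] at hx
    obtain ⟨u, hu, hux⟩ := hx
    obtain ⟨v, hv⟩ := hunit u hu
    have := Ideal.sub_mem _ (Ideal.mul_mem_left _ v hux) (Ideal.mul_mem_left _ x hv)
    convert this using 1
    ring
  have hsurj (x : R) : ∃ a : A, x - algebraMap A R a ∈ Ideal.ofList rs := by
    obtain ⟨a, u, rfl⟩ := IsLocalization.exists_mk'_eq p.primeCompl x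
    obtain ⟨v, hv⟩ := hunit u u.2
    refine ⟨a * v, ?_⟩
    have := Ideal.mul_mem_left _ (IsLocalization.mk' R a u)
      (hrs ▸ Ideal.mem_map_of_mem (algebraMap A R) hv)
    rw [← neg_mem_iff]
    convert this using 1
    rw [map_sub, map_mul, map_mul, mul_sub, ← mul_assoc, IsLocalization.mk'_spec]
    simp
  have hfin' : Module.Finite k (R ⧸ Ideal.ofList rs) := by
    refine Module.Finite.of_surjective (Ideal.quotientMapₐ (Ideal.ofList rs)
      (IsScalarTower.toAlgHom k A R) (Ideal.map_le_iff_le_comap.1 hrs.le)).toLinearMap fun x ↦ ?_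
    obtain ⟨x, rfl⟩ := Ideal.Quotient.mk_surjective x
    obtain ⟨a, ha⟩ := hsurj x
    exact ⟨Ideal.Quotient.mk _ a, ((Ideal.Quotient.mk_eq_mk_iff_sub_mem _ _).2 ha).symm⟩
  have hlen : IsFiniteLength R (R ⧸ Ideal.ofList rs) :=
    isFiniteLength_iff_isNoetherian_isArtinian.2
      ⟨isNoetherian_of_tower k inferInstance, isArtinian_of_tower k inferInstance⟩
  have := IsLocalization.isNoetherianRing p.primeCompl R inferInstance
  obtain ⟨r, hr⟩ := (hreg.of_isLocalization R p.primeCompl).exists_sub_mul_mem_of_mem_socle hinj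
    (s := algebraMap A R s) (t := algebraMap A R t) (fun r hr ↦ by
      obtain ⟨y, hy, rfl⟩ := List.mem_map.1 hr
      exact (IsLocalization.AtPrime.to_map_mem_maximal_iff R p y).2 (hmem y hy))
    hlen (fun h ↦ hs (hcomap s h)) fun a ha ↦ by
      have h : p.map (algebraMap A R) ≤
          Submodule.comap (LinearMap.mulRight R (algebraMap A R t)) (Ideal.ofList rs) := by
        refine Submodule.span_le.2 ?_
        rintro _ ⟨x, hx, rfl⟩
        change algebraMap A R x * algebraMap A R t ∈ Ideal.ofList rs
        rw [← map_mul, ← hrs]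
        exact Ideal.mem_map_of_mem _ (ht x hx)
      rw [← IsLocalization.AtPrime.map_eq_maximalIdeal p R] at ha
      exact h ha
  obtain ⟨a, ha⟩ := hsurj r
  refine ⟨a, hcomap _ ?_⟩
  have := Ideal.add_mem _ hr (Ideal.mul_mem_right (algebraMap A R s) _ ha)
  convert this using 1
  simp only [map_sub, map_mul]
  ring

/-! ### Homogeneous bases of graded Artinian quotients. -/

/-- In a basis of homogeneous classes, a homogeneous class of degree `l` has only coordinates at
basis vectors of degree `l`. -/
theorem MvPolynomial.IsHomogeneous.degree_eq_of_repr_ne_zero {σ k B ι : Type*} [Field k]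
    [CommRing B] [Algebra k B] (φ : MvPolynomial σ k →ₐ[k] B)
    (hφ : (RingHom.ker φ).IsHomogeneous (homogeneousSubmodule σ k)) [Finite ι]
    (b : Module.Basis ι k B) {E : ι → MvPolynomial σ k} {m : ι → ℕ}
    (hE : ∀ i, (E i).IsHomogeneous (m i)) (hb : ∀ i, φ (E i) = b i)
    {P : MvPolynomial σ k} {l : ℕ} (hP : P.IsHomogeneous l) {i : ι}
    (hi : b.repr (φ P) i ≠ 0) : m i = l := by
  classical
  have := Fintype.ofFinite ι
  by_contra hne
  let Q := P - ∑ j, b.repr (φ P) j • E j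
  have hQ : Q ∈ RingHom.ker φ := by
    simp only [Q, RingHom.mem_ker, map_sub, map_sum, map_smul, hb, b.sum_repr, sub_self]
  have hQl : homogeneousComponent (m i) Q ∈ RingHom.ker φ :=
    homogeneousComponent_mem_of_mem hφ hQ _
  -- As `l ≠ m i`, the form `P` contributes nothing in degree `m i`. What remains is a relation
  -- among basis vectors of that degree.
  have hcomp : homogeneousComponent (m i) Q =
      - ∑ j, if m j = m i then b.repr (φ P) j • E j else 0 := by
    simp only [Q, map_sub, map_sum, map_smul]
    rw [homogeneousComponent_of_mem hP, if_neg hne, zero_sub]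
    congr 1
    refine Finset.sum_congr rfl fun j _ ↦ ?_
    rw [homogeneousComponent_of_mem (hE j)]
    by_cases h : m j = m i <;> simp [h, Ne.symm]
  rw [hcomp, neg_mem_iff, RingHom.mem_ker, map_sum] at hQl
  refine hi ?_
  have := congr(b.repr $hQl i)
  simp only [apply_ite φ, map_smul, hb, map_zero, map_sum, apply_ite b.repr, Finsupp.coe_zero,
    Finsupp.finsetSum_apply, Pi.zero_apply] at this
  rw [Finset.sum_eq_single i] at this
  · simpa using this
  · intro j _ hj
    split_ifs <;> simp [hj]
  · simp

/-- Nondegeneracy of the pairing `(x, y) ↦` coefficient of `x * y` at `b t`, for a basis `b` that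
is homogeneous of degrees `m`, forces `m` to be symmetric. -/
theorem Module.Basis.degree_add_degree_rev {k B : Type*} [Field k] [CommRing B] [Algebra k B]
    {d : ℕ} (b : Module.Basis (Fin d) k B) {m : Fin d → ℕ} (hm : Monotone m) (t : Fin d)
    (hmul : ∀ i j, b.repr (b i * b j) t ≠ 0 → m i + m j = m t)
    (hsoc : ∀ s : B, s ≠ 0 → ∃ a, b t = a * s) (i : Fin d) : m i + m i.rev = m t := by
  let G : Matrix (Fin d) (Fin d) k := Matrix.of fun i j ↦ b.repr (b i * b j) t
  have hdet : G.det ≠ 0 := by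
    intro h
    obtain ⟨v, hv, hvG⟩ := Matrix.exists_vecMul_eq_zero_iff.2 h
    -- A kernel vector of `G` gives a nonzero element all of whose multiples have coefficient `0` at
    -- `b t`, yet `b t` is one of them.
    obtain ⟨a, ha⟩ := hsoc (∑ i, v i • b i) fun h0 ↦
      hv (funext (Fintype.linearIndependent_iff.1 b.linearIndependent v h0))
    have h1 : b.repr (a * ∑ i, v i • b i) t = 0 := by
      have : a * ∑ i, v i • b i = ∑ j, b.repr a j • ∑ i, v i • (b i * b j) := by
        conv_lhs => rw [← b.sum_repr a]
        rw [Finset.sum_mul]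
        refine Finset.sum_congr rfl fun j _ ↦ ?_
        rw [smul_mul_assoc, Finset.mul_sum]
        congr 1
        refine Finset.sum_congr rfl fun i _ ↦ ?_
        rw [mul_smul_comm, mul_comm]
      rw [this, map_sum, Finsupp.finsetSum_apply]
      refine Finset.sum_eq_zero fun j _ ↦ ?_
      have := congrFun hvG j
      simp only [Matrix.vecMul, dotProduct, G, Matrix.of_apply, Pi.zero_apply] at this
      simp [this]
    rw [← ha] at h1
    simp at h1
  rw [Matrix.det_apply] at hdet
  obtain ⟨σ, -, hσ⟩ := Finset.exists_ne_zero_of_sum_ne_zero hdet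
  have hG (j : Fin d) : m (σ j) + m j = m t := by
    refine hmul _ _ fun h0 ↦ hσ ?_
    rw [Finset.prod_eq_zero (Finset.mem_univ j) h0, smul_zero]
  have hmono : Monotone (m ∘ (Fin.revPerm.trans σ)) := fun x y hxy ↦ by
    have h1 := hG x.rev
    have h2 := hG y.rev
    have h3 : m y.rev ≤ m x.rev := hm (Fin.rev_le_rev.2 hxy)
    simp only [Function.comp_apply, Equiv.trans_apply, Fin.revPerm_apply]
    omega
  -- Two nondecreasing rearrangements of `m` coincide, so `m (σ i.rev) = m i`.
  have hu := Tuple.unique_monotone (f := m) (σ := Equiv.refl _) (τ := Fin.revPerm.trans σ) hm hmono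
  have h1 := congrFun hu i
  have h2 := hG i.rev
  simp only [Function.comp_apply, Equiv.trans_apply, Fin.revPerm_apply, Equiv.refl_apply] at h1
  omega

/-- A basis over the subalgebra generated by forms `Y` of positive degree descends to a basis over
the ground field of the quotient by `Y`. -/
theorem Module.Basis.exists_basis_quotient_span {k σ A ι κ : Type*} [Field k] [CommRing A]
    [Algebra (MvPolynomial σ k) A] [Algebra k A] [IsScalarTower k (MvPolynomial σ k) A] [Finite ι]
    [Fintype κ]
    {Y : κ → MvPolynomial σ k} (hY : ∀ j, MvPolynomial.constantCoeff (Y j) = 0)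
    (e : Module.Basis ι (Algebra.adjoin k (Set.range Y)) A) {K : Ideal A}
    (hK : K = Ideal.span (Set.range fun j ↦ algebraMap (MvPolynomial σ k) A (Y j))) :
    ∃ b : Module.Basis ι k (A ⧸ K), ∀ i, b i = Ideal.Quotient.mk K (e i) := by
  have := Fintype.ofFinite ι
  have hmemY (j : κ) : Y j ∈ Algebra.adjoin k (Set.range Y) := Algebra.subset_adjoin ⟨j, rfl⟩
  -- Coordinates of elements of `K` lie in the ideal of the subalgebra generated by `Y`; this gives
  -- linear independence below, and `hY0` gives spanning.
  have hK0 (x : A) (hx : x ∈ K) (i : ι) : MvPolynomial.constantCoeff (e.repr x i).1 = 0 := by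
    rw [hK, Ideal.mem_span_range_iff_exists_fun] at hx
    obtain ⟨c, rfl⟩ := hx
    have (j : κ) : c j * algebraMap (MvPolynomial σ k) A (Y j) =
        (⟨Y j, hmemY j⟩ : Algebra.adjoin k (Set.range Y)) • c j := by
      rw [mul_comm, ← Algebra.smul_def]; rfl
    simp only [this, map_sum, map_smul, Finsupp.finsetSum_apply]
    simp [hY]
  have hY0 (p : MvPolynomial σ k) (hp : p ∈ Algebra.adjoin k (Set.range Y)) :
      algebraMap (MvPolynomial σ k) A (p - MvPolynomial.C (MvPolynomial.constantCoeff p)) ∈ K := by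
    rw [← Ideal.mem_comap]
    induction hp using Algebra.adjoin_induction with
    | mem x hx =>
      obtain ⟨j, rfl⟩ := hx
      rw [hY, map_zero, sub_zero, Ideal.mem_comap, hK]
      exact Ideal.subset_span ⟨j, rfl⟩
    | algebraMap r => simp [MvPolynomial.algebraMap_eq]
    | add x y _ _ hx hy =>
      convert Ideal.add_mem _ hx hy using 1
      simp only [map_add]; ring
    | mul x y _ _ hx hy =>
      convert Ideal.add_mem _ (Ideal.mul_mem_left _ x hy)
        (Ideal.mul_mem_right (MvPolynomial.C (MvPolynomial.constantCoeff y)) _ hx) using 1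
      simp only [map_mul]; ring
  have hli : LinearIndependent k fun i ↦ Ideal.Quotient.mk K (e i) := by
    rw [Fintype.linearIndependent_iff]
    intro c hc i
    have hmem : ∑ i, c i • e i ∈ K := by
      rw [← Ideal.Quotient.eq_zero_iff_mem, map_sum, ← hc]
      rfl
    have h := hK0 _ hmem i
    have hsum : ∑ i, c i • e i = ∑ i, algebraMap k (Algebra.adjoin k (Set.range Y)) (c i) • e i := by
      refine Finset.sum_congr rfl fun i _ ↦ ?_
      change _ = algebraMap k (MvPolynomial σ k) (c i) • e i
      rw [algebraMap_smul]
    rw [hsum, e.repr_sum_self] at h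
    simpa [MvPolynomial.algebraMap_eq] using h
  have hsp : ⊤ ≤ Submodule.span k (Set.range fun i ↦ Ideal.Quotient.mk K (e i)) := by
    rintro x -
    obtain ⟨x, rfl⟩ := Ideal.Quotient.mk_surjective x
    rw [← e.sum_repr x, map_sum]
    refine Submodule.sum_mem _ fun i _ ↦ ?_
    have : Ideal.Quotient.mk K (e.repr x i • e i) =
        MvPolynomial.constantCoeff (e.repr x i).1 • Ideal.Quotient.mk K (e i) := by
      change _ = Ideal.Quotient.mk K (MvPolynomial.constantCoeff (e.repr x i).1 • e i)
      rw [Ideal.Quotient.mk_eq_mk_iff_sub_mem]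
      convert Ideal.mul_mem_right (e i) _ (hY0 _ (e.repr x i).2) using 1
      rw [map_sub, sub_mul, ← Algebra.smul_def, ← Algebra.smul_def, ← MvPolynomial.algebraMap_eq,
        algebraMap_smul]
      rfl
    rw [this]
    exact Submodule.smul_mem _ _ (Submodule.subset_span ⟨i, rfl⟩)
  exact ⟨Module.Basis.mk hli hsp, fun i ↦ by simp⟩

/-- A homogeneous form whose degree exceeds all degrees of a homogeneous basis vanishes. -/
theorem MvPolynomial.IsHomogeneous.map_eq_zero_of_forall_lt {σ k B ι : Type*} [Field k]
    [CommRing B] [Algebra k B] (φ : MvPolynomial σ k →ₐ[k] B)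
    (hφ : (RingHom.ker φ).IsHomogeneous (homogeneousSubmodule σ k)) [Finite ι]
    (b : Module.Basis ι k B) {E : ι → MvPolynomial σ k} {m : ι → ℕ}
    (hE : ∀ i, (E i).IsHomogeneous (m i)) (hb : ∀ i, φ (E i) = b i)
    {P : MvPolynomial σ k} {l : ℕ} (hP : P.IsHomogeneous l) (hl : ∀ i, m i < l) : φ P = 0 := by
  by_contra h
  obtain ⟨j, hj⟩ := Finsupp.ne_iff.1 ((LinearEquiv.map_ne_zero_iff b.repr).2 h)
  exact (hl j).ne (hP.degree_eq_of_repr_ne_zero φ hφ b hE hb hj)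

/-- Modulo the variables, every polynomial is congruent to its constant coefficient. -/
theorem MvPolynomial.ker_constantCoeff_le {σ k : Type*} [CommRing k]
    {J : Ideal (MvPolynomial σ k)} (hJ : ∀ i, X i ∈ J) :
    RingHom.ker (constantCoeff (R := k) (σ := σ)) ≤ J := by
  have h (P : MvPolynomial σ k) : P - C (constantCoeff P) ∈ J := by
    induction P using MvPolynomial.induction_on with
    | C a => simp
    | add p q hp hq =>
      convert J.add_mem hp hq using 1
      simp only [map_add]; ring
    | mul_X p i _ => simpa using J.mul_mem_left p (hJ i)
  intro P hP
  simpa [(RingHom.mem_ker).1 hP] using h P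

/-- In a graded Artinian quotient of a polynomial ring the classes of polynomials with nonzero
constant coefficient are units. -/
theorem MvPolynomial.isUnit_map_of_constantCoeff_ne_zero {σ k B : Type*} [Field k]
    [CommRing B] [Algebra k B] (φ : MvPolynomial σ k →ₐ[k] B) {D : ℕ}
    (hφ : ∀ P : MvPolynomial σ k, P.IsHomogeneous D → φ P = 0) {u : MvPolynomial σ k}
    (hu : constantCoeff u ≠ 0) : IsUnit (φ u) := by
  have hnil : RingHom.ker (constantCoeff (R := k) (σ := σ)) ≤ (nilradical B).comap φ :=
    ker_constantCoeff_le fun i ↦ ⟨D, by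
      rw [← map_pow]
      exact hφ _ (by simpa using (isHomogeneous_X k i).pow D)⟩
  have h : IsNilpotent (φ (u - C (constantCoeff u))) := hnil (by simp [RingHom.mem_ker])
  have hc : IsUnit (φ (C (constantCoeff u))) := (hu.isUnit.map C).map φ
  have := h.isUnit_add_left_of_commute hc (Commute.all _ _)
  simpa using this

/-- If the irrelevant socle of a graded Artinian quotient of a polynomial ring lies in each nonzero
ideal, then the degrees of a homogeneous basis are symmetric. -/
theorem MvPolynomial.degree_add_degree_rev_of_socle {σ k B : Type*} [Field k]
    [CommRing B] [Algebra k B] (φ : MvPolynomial σ k →ₐ[k] B)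
    (hφ : (RingHom.ker φ).IsHomogeneous (homogeneousSubmodule σ k)) {d : ℕ}
    (b : Module.Basis (Fin d) k B) {E : Fin d → MvPolynomial σ k} {m : Fin d → ℕ}
    (hE : ∀ i, (E i).IsHomogeneous (m i)) (hb : ∀ i, φ (E i) = b i) (hm : Monotone m)
    (hsoc : ∀ (s : B) (t : MvPolynomial σ k), s ≠ 0 →
      (∀ P, constantCoeff P = 0 → φ (P * t) = 0) → ∃ a, φ t = a * s)
    (t : Fin d) (ht : ∀ i, i ≤ t) (i : Fin d) : m i + m i.rev = m t := by
  refine b.degree_add_degree_rev hm t (fun i j h ↦ ?_) (fun s hs ↦ ?_) i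
  · rw [← hb, ← hb, ← map_mul] at h
    exact (((hE i).mul (hE j)).degree_eq_of_repr_ne_zero φ hφ b hE hb h).symm
  · rw [← hb]
    refine hsoc s _ hs fun P hP ↦ ?_
    refine ker_constantCoeff_le (J := Submodule.comap (LinearMap.mulRight (MvPolynomial σ k) (E t)) (RingHom.ker φ))
      (fun j ↦ ?_) hP
    exact ((isHomogeneous_X k j).mul (hE t)).map_eq_zero_of_forall_lt φ hφ b hE hb fun i ↦ by
      have := hm (ht i)
      omega

/-! ### Gorenstein graded rings and the symmetry of degrees. -/

open RingTheory.Sequence MvPolynomial in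
/-- The socle of the quotient of a Gorenstein graded ring by a regular sequence of forms of positive
degree lies in each nonzero ideal, if that quotient is Artinian. -/
theorem IsGorensteinRing.exists_eq_mul_of_mem_socle {k σ A : Type*} [Field k] [CommRing A]
    [Algebra (MvPolynomial σ k) A] [Algebra k A]
    (hGor : IsGorensteinRing A)
    (hsurj : Function.Surjective (algebraMap (MvPolynomial σ k) A))
    {ys : List A} (hreg : IsWeaklyRegular A ys) (hfin : Module.Finite k (A ⧸ Ideal.ofList ys))
    (hys : ∀ P, algebraMap (MvPolynomial σ k) A P ∈ Ideal.ofList ys → constantCoeff P = 0)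
    (hunit : ∀ u : MvPolynomial σ k, constantCoeff u ≠ 0 →
      IsUnit (Ideal.Quotient.mk (Ideal.ofList ys) (algebraMap _ A u)))
    {s : A ⧸ Ideal.ofList ys} {t : MvPolynomial σ k} (hs : s ≠ 0)
    (ht : ∀ P, constantCoeff P = 0 → algebraMap _ A (P * t) ∈ Ideal.ofList ys) :
    ∃ a, Ideal.Quotient.mk (Ideal.ofList ys) (algebraMap _ A t) = a * s := by
  -- The irrelevant ideal, at which the Gorenstein hypothesis is applied.
  let p : Ideal A := (RingHom.ker (constantCoeff (R := k) (σ := σ))).map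
    (algebraMap (MvPolynomial σ k) A)
  have hmem (P : MvPolynomial σ k) (hP : algebraMap (MvPolynomial σ k) A P ∈ p) :
      constantCoeff P = 0 := by
    obtain ⟨Q, hQ, hPQ⟩ := (Ideal.mem_map_iff_of_surjective _ hsurj).1 hP
    have := hys (Q - P) (by rw [map_sub, hPQ, sub_self]; exact zero_mem _)
    rwa [map_sub, (RingHom.mem_ker).1 hQ, zero_sub, neg_eq_zero] at this
  have hker : (RingHom.ker (constantCoeff (R := k) (σ := σ))).IsMaximal :=
    RingHom.ker_isMaximal_of_surjective _ fun c ↦ ⟨C c, by simp⟩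
  have hp : p.IsMaximal := (Ideal.map_eq_top_or_isMaximal_of_surjective _ hsurj hker).resolve_left
    fun h ↦ one_ne_zero (α := k) (by simpa using hmem 1 (by rw [show p = ⊤ from h]; trivial))
  obtain ⟨N, hN⟩ := hGor.2 p
  have := hGor.1
  obtain ⟨s, rfl⟩ := Ideal.Quotient.mk_surjective s
  obtain ⟨a, ha⟩ := hreg.exists_sub_mul_mem_of_localization k p hN (s := s)
    (t := algebraMap _ A t) (fun y hy ↦ by
      obtain ⟨P, rfl⟩ := hsurj y
      exact Ideal.mem_map_of_mem _ (hys P (Ideal.subset_span hy))) hfin (fun u hu ↦ by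
      obtain ⟨P, rfl⟩ := hsurj u
      obtain ⟨v, hv⟩ := (hunit P fun h ↦ hu (Ideal.mem_map_of_mem _ h)).exists_right_inv
      obtain ⟨v, rfl⟩ := Ideal.Quotient.mk_surjective v
      exact ⟨v, (Ideal.Quotient.mk_eq_mk_iff_sub_mem _ _).1 hv⟩)
    (fun h ↦ hs (Ideal.Quotient.eq_zero_iff_mem.2 h)) (fun a ha ↦ by
      obtain ⟨P, rfl⟩ := hsurj a
      rw [← map_mul]
      exact ht P (hmem P ha))
  exact ⟨Ideal.Quotient.mk _ a, (Ideal.Quotient.mk_eq_mk_iff_sub_mem _ _).2 ha⟩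

open RingTheory.Sequence MvPolynomial in
/-- The degrees of a homogeneous basis of a Gorenstein graded ring over the subalgebra generated by
a regular sequence of linear forms are symmetric. -/
theorem IsGorensteinRing.degree_add_degree_rev {k σ A : Type*} [Field k] [CommRing A]
    [Algebra (MvPolynomial σ k) A] [Algebra k A] [IsScalarTower k (MvPolynomial σ k) A]
    (hGor : IsGorensteinRing A)
    (hsurj : Function.Surjective (algebraMap (MvPolynomial σ k) A))
    (hker : (RingHom.ker (algebraMap (MvPolynomial σ k) A)).IsHomogeneous
      (homogeneousSubmodule σ k)) {r : ℕ} {Y : Fin r → MvPolynomial σ k}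
    (hY : ∀ j, (Y j).IsHomogeneous 1) (hreg : IsWeaklyRegular A (List.ofFn Y)) {d : ℕ}
    (e : Module.Basis (Fin d) (Algebra.adjoin k (Set.range Y)) A) {E : Fin d → MvPolynomial σ k}
    {m : Fin d → ℕ} (hE : ∀ i, (E i).IsHomogeneous (m i)) (hEe : ∀ i, algebraMap _ A (E i) = e i)
    (hm : Monotone m) (t : Fin d) (ht : ∀ i, i ≤ t) (i : Fin d) : m i + m i.rev = m t := by
  obtain ⟨ys, hys⟩ : ∃ ys : List A, ys = (List.ofFn Y).map (algebraMap _ A) := ⟨_, rfl⟩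
  have hspan : Ideal.ofList ys = (Ideal.span (Set.range Y)).map (algebraMap _ A) := by
    rw [hys, ← Ideal.map_ofList, Ideal.ofList,
      show {x | x ∈ List.ofFn Y} = Set.range Y from Set.ext fun x ↦ by simp]
  obtain ⟨b, hb⟩ := e.exists_basis_quotient_span (fun j ↦ (hY j).coeff_eq_zero (by simp))
    (K := Ideal.ofList ys) (by
      rw [hspan, Ideal.map_span, ← Set.range_comp]
      rfl)
  let φ : MvPolynomial σ k →ₐ[k] A ⧸ Ideal.ofList ys :=
    (Ideal.Quotient.mkₐ k (Ideal.ofList ys)).comp (IsScalarTower.toAlgHom k (MvPolynomial σ k) A)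
  have hφ0 (P) : φ P = 0 ↔ algebraMap _ A P ∈ Ideal.ofList ys := Ideal.Quotient.eq_zero_iff_mem
  have hφ : (RingHom.ker φ).IsHomogeneous (homogeneousSubmodule σ k) := by
    have : RingHom.ker φ =
        Ideal.span (Set.range Y) ⊔ RingHom.ker (algebraMap (MvPolynomial σ k) A) := by
      ext P
      rw [RingHom.mem_ker, hφ0, hspan, ← Ideal.mem_comap, Ideal.comap_map_of_surjective' _ hsurj]
    rw [this]
    refine Ideal.IsHomogeneous.sup (Ideal.homogeneous_span _ _ ?_) hker
    rintro _ ⟨j, rfl⟩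
    exact ⟨1, hY j⟩
  have hφE (i) : φ (E i) = b i := by
    rw [hb, ← hEe]; rfl
  refine degree_add_degree_rev_of_socle φ hφ b hE hφE hm (fun s P hs hP ↦ ?_) t ht i
  refine hGor.exists_eq_mul_of_mem_socle hsurj ?_ (Module.Finite.of_basis b) (fun Q hQ ↦ ?_)
    (fun u hu ↦ ?_) hs fun Q hQ ↦ (hφ0 _).1 (hP Q hQ)
  · rw [hys]
    exact (isWeaklyRegular_map_algebraMap_iff A A _).2 hreg
  -- By homogeneity the kernel contains the degree `0` component of `Q`, a nonzero constant, which
  -- is impossible as the quotient is nontrivial.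
  · by_contra h
    have h0 := homogeneousComponent_mem_of_mem hφ ((hφ0 Q).2 hQ) 0
    rw [homogeneousComponent_zero, RingHom.mem_ker] at h0
    have h1 : IsUnit (φ (C (coeff 0 Q))) := ((Ne.isUnit h).map C).map φ
    have : Nontrivial (A ⧸ Ideal.ofList ys) := ⟨_, _, hs⟩
    exact h1.ne_zero h0
  · exact isUnit_map_of_constantCoeff_ne_zero φ (D := m t + 1)
      (fun P hP ↦ hP.map_eq_zero_of_forall_lt φ hφ b hE hφE fun j ↦
        Nat.lt_succ_of_le (hm (ht j))) hu

theorem mainTheorem3 {k : Type*} [Field k] [IsAlgClosed k] [CharZero k] {n : ℕ}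
    (I : Ideal (MvPolynomial (Fin (n + 1)) k))
    (hI : I.IsHomogeneous (MvPolynomial.homogeneousSubmodule (Fin (n + 1)) k))
    (hGor : IsArithmeticallyGorenstein I)
    {d : ℕ} (m : Fin d → ℕ) (hm : IsCharacteristicSequence I m) (i : Fin d) :
    m i + m ⟨d - 1 - i, by have := i.isLt; omega⟩ = m ⟨d - 1, by have := i.isLt; omega⟩ := by
  obtain ⟨hmono, r, Y, -, hY, hreg, e, he⟩ := hm
  choose E hE hEe using he
  have hrev : (⟨d - 1 - i, by have := i.isLt; omega⟩ : Fin d) = i.rev :=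
    Fin.ext (by simp [Fin.val_rev]; omega)
  rw [hrev]
  refine IsGorensteinRing.degree_add_degree_rev hGor Ideal.Quotient.mk_surjective ?_ hY hreg.1 e hE
    hEe hmono _ (fun j ↦ Fin.le_def.2 (by have := j.isLt; simp; omega)) i
  rwa [Ideal.Quotient.algebraMap_eq, Ideal.mk_ker]
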